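/- **Setting.** Fix a probability space, $\Sigma=\{1,\dots,d\}$, and processes indexed by $t\in\mathbb Z$; equalities of random variables are almost sure. For a process $\mu=(\mu_1,\dots,\mu_d)^T$ and a word $w=\sigma_1\cdots\sigma_k$ over $\Sigma$ put $\mu_w(t)=\mu_{\sigma_1}(t-k+1)\cdots\mu_{\sigma_k}(t)$, $\mu_\epsilon=1$; for matrices $A_\sigma$ put $A_w=A_{\sigma_k}\cdots A_{\sigma_1}$, $A_\epsilon=I$. For $\mathcal E\subseteq\Sigma\times\Sigma$, let $L$ be the set of nonempty words all of whose consecutive pairs of letters lie in $\mathcal E$. Let $\mathcal F_t^-=\sigma(\mu(k):k<t)$ and $\mathcal F_t^+=\sigma(\mu(k):k\ge t)$. The switching process $\mu$ is *admissible*, with data $\mathcal E$ and $p_\sigma>0$, if: every $\sigma$ has some $\sigma'$ with $(\sigma,\sigma')\in\mathcal E$; $\mu_w=0$ for nonempty $w\notin L$; for all nonempty $w,v$ and all $\sigma,\sigma',t$, $E[\mu_{w\sigma}(t)\mu_{v\sigma'}(t)\mid\mathcal F_t^-]$ equals $p_\sigma\mu_w(t-1)\mu_v(t-1)$ if $\sigma=\sigma'$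 and $w\sigma,v\sigma\in L$, and $0$ otherwise; $E[\mu_{w\sigma}(t)\mu_{\sigma'}(t)\mid\mathcal F_t^-]$ equals $p_\sigma\mu_w(t-1)$ if $\sigma=\sigma'$ and $w\sigma\in L$, and $0$ otherwise; $E[\mu_\sigma(t)\mu_{\sigma'}(t)\mid\mathcal F_t^-]=0$ for $\sigma\neq\sigma'$; $\sum_\sigma\alpha_\sigma\mu_\sigma(t)=1$ for all $t$, for some real constants $\alpha_\sigma$; and $[\mu_w,\mu_v]^T$ is wide-sense stationary for all nonempty $w,v$. For a process $r$ put $z^r_w(t)=r(t-|w|)\,\mu_w(t-1)/\sqrt{p_w}$, with $p_{\sigma_1\cdots\sigma_k}=p_{\sigma_1}\cdots p_{\sigma_k}$. The process $r$ is *ZMWSSI* if, for every $t$, $\sigma(r(k):k\le t)$ and $\mathcal F_t^+$ are conditionally independent given $\mathcal F_t^-$, and the processes $r$, $z^r_w$ ($w\ne\epsilon$) are zero mean, square integrable and jointly wide-sense stationary. A ZMWSSI process $r$ is a *white noise w.r.t. $\mu$* if $E[z^r_w(t)z^r_v(t)^T]=0$ for nonempty $w\neq v$, $E[z^r_{\sigma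 v}(t)z^r_{\sigma v}(t)^T]=E[z^r_\sigma(t)z^r_\sigma(t)^T]$ whenever $\sigma v\in L$, and $E[z^r_\sigma(t)z^r_\sigma(t)^T]$ is nonsingular for every $\sigma$. A *stationary GLSS (sGLSS)* $\mathbf S=(\{A_\sigma,K_\sigma,B_\sigma\}_{\sigma\in\Sigma},C,D,F,v)$ of $(y,u,\mu)$ consists of real matrices and a noise process $v$ for which there is a state process $x$ with $$x(t+1)=\sum_{\sigma}(A_\sigma x(t)+B_\sigma u(t)+K_\sigma v(t))\mu_\sigma(t),\qquad y(t)=Cx(t)+Du(t)+Fv(t)\qquad(t\in\mathbb Z),$$ such that, with $\omega=[v^T,u^T]^T$: $\omega$ is a white noise w.r.t. $\mu$; $[x^T,\omega^T]^T$ is ZMWSSI, $E[z^x_\sigma(t)z^\omega_\sigma(t)^T]=0$ and $E[z^x_w(t)\omega(t)^T]=0$ for all $\sigma\in\Sigma$ and nonempty $w$; all eigenvalues of $\sum_\sigma p_\sigma A_\sigma\otimes A_\sigma$ lie in the open unit disc; and for $(\sigma_1,\sigma_2)\notin\mathcal E$, $A_{\sigma_2}A_{\sigma_1}=0$ and $A_{\sigma_2}[K_{\sigma_1},B_{\sigma_1}]E[z^\omega_{\sigma_1}(t)z^\omega_{\sigma_1}(t)^T]=0$.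 Let $E_l[\,\cdot\mid G]$ be the coordinatewise orthogonal projection in $L^2$ onto the closed linear span of the coordinates of the elements of $G$. Put $y^d(t)=E_l[y(t)\mid\{z^u_w(t)\}_{w\ne\epsilon}\cup\{u(t)\}]$, $y^s=y-y^d$ and $e^s(t)=y^s(t)-E_l[y^s(t)\mid\{z^{y^s}_w(t)\}_{w\neq\epsilon}]$. The sGLSS $\mathbf S$ is in *innovation form* if $F=I$ and $v=e^s$. The stochastic part $\mathbf S_s=(\{A_\sigma,K_\sigma\}_{\sigma\in\Sigma},C,F,v)$ is *observable* if $\bigcap_w\ker CA_w=\{0\}$, the intersection being over all words $w$, including $\epsilon$. It is *reachable* if the columns of all matrices $A_wG_\sigma$ ($w$ any word, including $\epsilon$, and $\sigma\in\Sigma$) span the state space, where $G_\sigma=p_\sigma^{-1/2}(A_\sigma X_\sigma C^T+K_\sigma Q_\sigma F^T)$, $Q_\sigma=E[v(t)v(t)^T\mu_\sigma^2(t)]$, and $(X_\sigma)_\sigma$ is the solution of $X_\sigma=p_\sigma\sum_{\sigma':(\sigma',\sigma)\in\mathcal E}(A_{\sigma'}X_{\sigma'}A_{\sigma'}^T+K_{\sigma'}Q_{\sigma'}K_{\sigma'}^T)$.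 **Corollary 3 (Isomorphism).** Let $\mu$ be admissible, and let $\mathbf S=(\{A_\sigma,K_\sigma,B_\sigma\},C,D,I,e^s)$ and $\hat{\mathbf S}=(\{\hat A_\sigma,\hat K_\sigma,\hat B_\sigma\},\hat C,\hat D,I,e^s)$, of possibly different state dimensions, be two sGLSSs of $(y,u,\mu)$ in innovation form whose stochastic parts $\mathbf S_s$ and $\hat{\mathbf S}_s$ are reachable and observable. Assume that for every $\sigma\in\Sigma$ the matrix $E[e^s(t)e^s(t)^T\mu_\sigma^2(t)]$ is nonsingular and $$\operatorname{Im}\begin{bmatrix}B_\sigma\\ \hat B_\sigma\end{bmatrix}\subseteq\operatorname{Im}\begin{bmatrix}K_\sigma\\ \hat K_\sigma\end{bmatrix},$$ and that $\hat D=D$. Then there is a nonsingular matrix $T$ (in particular, the state dimensions agree) such that for all $\sigma\in\Sigma$ $$TA_\sigma T^{-1}=\hat A_\sigma,\qquad T[K_\sigma,B_\sigma]=[\hat K_\sigma,\hat B_\sigma],\qquad CT^{-1}=\hat C.$$ -/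

import Mathlib

open MeasureTheory

noncomputable section

/-! ## Words, switching products and the processes `z_w`

The alphabet is `Fin d`; words are lists, the empty word is `[]`, and the word
`σ₁ σ₂ ⋯ σₖ` is the list `[σ₁, σ₂, …, σₖ]`. A process with values in `ℝ^ι` is a function
`ℤ → Ω → ι → ℝ`; equalities between random variables are meant almost surely. -/

/-- `A_w = A_{σₖ} ⋯ A_{σ₁}` for `w = σ₁ ⋯ σₖ`, and `A_ε = I`. -/
def wordProd {d n : ℕ} (A : Fin d → Matrix (Fin n) (Fin n) ℝ) :
    List (Fin d) → Matrix (Fin n) (Fin n) ℝ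
  | [] => 1
  | σ :: w => wordProd A w * A σ

/-- `μ_w(t) = μ_{σ₁}(t-k+1) ⋯ μ_{σₖ}(t)` for `w = σ₁ ⋯ σₖ`, and `μ_ε(t) = 1`. -/
def switchProd {Ω : Type*} {d : ℕ} (μ : ℤ → Ω → Fin d → ℝ) : List (Fin d) → ℤ → Ω → ℝ
  | [], _, _ => 1
  | σ :: w, t, ω => μ (t - (w.length : ℤ)) ω σ * switchProd μ w t ω

/-- `p_w = p_{σ₁} ⋯ p_{σₖ}`. -/
def wordWeight {d : ℕ} (p : Fin d → ℝ) (w : List (Fin d)) : ℝ := (w.map p).prod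

/-- `z_w^r(t) = r(t - |w|) μ_w(t-1) / √p_w`; in particular `z_ε^r = r`. -/
def zProc {Ω ι : Type*} {d : ℕ} (μ : ℤ → Ω → Fin d → ℝ) (p : Fin d → ℝ) (r : ℤ → Ω → ι → ℝ)
    (w : List (Fin d)) (t : ℤ) (ω : Ω) (i : ι) : ℝ :=
  r (t - (w.length : ℤ)) ω i * switchProd μ w (t - 1) ω / Real.sqrt (wordWeight p w)

/-- The set `L` of admissible words: the nonempty words all of whose consecutive pairs of
letters lie in `E`. -/
def IsAdmissibleWord {d : ℕ} (E : Fin d → Fin d → Prop) (w : List (Fin d)) : Prop :=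
  w ≠ [] ∧ w.IsChain E

/-- The process `[r₁ᵀ, r₂ᵀ]ᵀ`. -/
def stack {Ω ι κ : Type*} (r₁ : ℤ → Ω → ι → ℝ) (r₂ : ℤ → Ω → κ → ℝ) : ℤ → Ω → ι ⊕ κ → ℝ :=
  fun t ω => Sum.elim (r₁ t ω) (r₂ t ω)

/-- The matrix `E[f gᵀ]`. -/
def crossMoment {Ω ι κ : Type*} [MeasurableSpace Ω] (P : Measure Ω) (f : Ω → ι → ℝ)
    (g : Ω → κ → ℝ) : Matrix ι κ ℝ :=
  Matrix.of fun i j => ∫ ω, f ω i * g ω j ∂P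

/-- The matrix `E[r(t) r(t)ᵀ μ_σ(t)²]`. -/
def switchedCov {Ω ι : Type*} [MeasurableSpace Ω] (P : Measure Ω) {d : ℕ}
    (μ : ℤ → Ω → Fin d → ℝ) (r : ℤ → Ω → ι → ℝ) (σ : Fin d) (t : ℤ) : Matrix ι ι ℝ :=
  Matrix.of fun i j => ∫ ω, r t ω i * r t ω j * (μ t ω σ) ^ 2 ∂P

/-! ## Sigma-algebras and stationarity -/

/-- The σ-algebra generated by `r(k)`, `k ≤ t`. -/
abbrev sigmaUpTo {Ω ι : Type*} (r : ℤ → Ω → ι → ℝ) (t : ℤ) : MeasurableSpace Ω :=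
  ⨆ (k : ℤ) (_ : k ≤ t), MeasurableSpace.comap (r k) MeasurableSpace.pi

/-- The σ-algebra generated by `r(k)`, `k < t`. -/
abbrev sigmaBefore {Ω ι : Type*} (r : ℤ → Ω → ι → ℝ) (t : ℤ) : MeasurableSpace Ω :=
  ⨆ (k : ℤ) (_ : k < t), MeasurableSpace.comap (r k) MeasurableSpace.pi

/-- The σ-algebra generated by `r(k)`, `k ≥ t`. -/
abbrev sigmaFrom {Ω ι : Type*} (r : ℤ → Ω → ι → ℝ) (t : ℤ) : MeasurableSpace Ω :=
  ⨆ (k : ℤ) (_ : t ≤ k), MeasurableSpace.comap (r k) MeasurableSpace.pi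

/-- The σ-algebras `m₁` and `m₂` are conditionally independent with respect to `m`:
`P(A ∩ B | m) = P(A | m) P(B | m)` almost surely for all `A ∈ m₁`, `B ∈ m₂`. -/
def CondIndepSigma {Ω : Type*} [MeasurableSpace Ω] (P : Measure Ω)
    (m m₁ m₂ : MeasurableSpace Ω) : Prop :=
  ∀ A B : Set Ω, MeasurableSet[m₁] A → MeasurableSet[m₂] B →
    P[(A ∩ B).indicator (fun _ => (1 : ℝ)) | m] =ᵐ[P]
      fun ω => (P[A.indicator (fun _ => (1 : ℝ)) | m]) ω *
        (P[B.indicator (fun _ => (1 : ℝ)) | m]) ω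

/-- A family of scalar processes is square integrable and jointly wide-sense stationary. -/
def JointlyWSS {Ω J : Type*} [MeasurableSpace Ω] (P : Measure Ω) (f : J → ℤ → Ω → ℝ) : Prop :=
  (∀ j t, MemLp (f j t) 2 P) ∧
  (∀ j s t, ∫ ω, f j s ω ∂P = ∫ ω, f j t ω ∂P) ∧
  (∀ i j s t k, ∫ ω, f i (s + k) ω * f j (t + k) ω ∂P = ∫ ω, f i s ω * f j t ω ∂P)

/-- The switching process `μ` is admissible, with set of admissible pairs `E` and constants
`p_σ`. -/
structure IsAdmissibleSwitching {Ω : Type*} [MeasurableSpace Ω] (P : Measure Ω) {d : ℕ}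
    (μ : ℤ → Ω → Fin d → ℝ) (E : Fin d → Fin d → Prop) (p : Fin d → ℝ) : Prop where
  measurable : ∀ t, Measurable (μ t)
  exists_next : ∀ σ, ∃ σ', E σ σ'
  eq_zero : ∀ w : List (Fin d), w ≠ [] → ¬ IsAdmissibleWord E w →
    ∀ t, ∀ᵐ ω ∂P, switchProd μ w t ω = 0
  p_pos : ∀ σ, 0 < p σ
  condExp_same : ∀ (w v : List (Fin d)) (σ : Fin d) (t : ℤ), w ≠ [] → v ≠ [] →
    IsAdmissibleWord E (w ++ [σ]) → IsAdmissibleWord E (v ++ [σ]) →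
    P[fun ω => switchProd μ (w ++ [σ]) t ω * switchProd μ (v ++ [σ]) t ω | sigmaBefore μ t]
      =ᵐ[P] fun ω => p σ * switchProd μ w (t - 1) ω * switchProd μ v (t - 1) ω
  condExp_other : ∀ (w v : List (Fin d)) (σ σ' : Fin d) (t : ℤ), w ≠ [] → v ≠ [] →
    ¬ (σ = σ' ∧ IsAdmissibleWord E (w ++ [σ]) ∧ IsAdmissibleWord E (v ++ [σ])) →
    P[fun ω => switchProd μ (w ++ [σ]) t ω * switchProd μ (v ++ [σ']) t ω | sigmaBefore μ t]
      =ᵐ[P] fun _ => 0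
  condExp_letter_same : ∀ (w : List (Fin d)) (σ : Fin d) (t : ℤ), w ≠ [] →
    IsAdmissibleWord E (w ++ [σ]) →
    P[fun ω => switchProd μ (w ++ [σ]) t ω * μ t ω σ | sigmaBefore μ t]
      =ᵐ[P] fun ω => p σ * switchProd μ w (t - 1) ω
  condExp_letter_other : ∀ (w : List (Fin d)) (σ σ' : Fin d) (t : ℤ), w ≠ [] →
    ¬ (σ = σ' ∧ IsAdmissibleWord E (w ++ [σ])) →
    P[fun ω => switchProd μ (w ++ [σ]) t ω * μ t ω σ' | sigmaBefore μ t] =ᵐ[P] fun _ => 0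
  condExp_letters : ∀ (σ σ' : Fin d) (t : ℤ), σ ≠ σ' →
    P[fun ω => μ t ω σ * μ t ω σ' | sigmaBefore μ t] =ᵐ[P] fun _ => 0
  exists_sum_eq_one : ∃ α : Fin d → ℝ, ∀ t, ∀ᵐ ω ∂P, ∑ σ, α σ * μ t ω σ = 1
  wss : ∀ w v : List (Fin d), w ≠ [] → v ≠ [] →
    JointlyWSS P ![switchProd μ w, switchProd μ v]

/-- `r` is zero mean wide-sense stationary with respect to `μ`. The words in the last two
fields include the empty one, for which `z_ε^r = r`. -/
structure IsZMWSSI {Ω ι : Type*} [MeasurableSpace Ω] (P : Measure Ω) {d : ℕ}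
    (μ : ℤ → Ω → Fin d → ℝ) (p : Fin d → ℝ) (r : ℤ → Ω → ι → ℝ) : Prop where
  measurable : ∀ t, Measurable (r t)
  condIndep : ∀ t, CondIndepSigma P (sigmaBefore μ t) (sigmaUpTo r t) (sigmaFrom μ t)
  zero_mean : ∀ (w : List (Fin d)) (t : ℤ) (i : ι), ∫ ω, zProc μ p r w t ω i ∂P = 0
  wss : JointlyWSS P (fun (j : List (Fin d) × ι) t ω => zProc μ p r j.1 t ω j.2)

/-- `r` is a white noise process with respect to `μ`. -/
structure IsWhiteNoise {Ω ι : Type*} [MeasurableSpace Ω] [Fintype ι] [DecidableEq ι]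
    (P : Measure Ω) {d : ℕ} (μ : ℤ → Ω → Fin d → ℝ) (E : Fin d → Fin d → Prop)
    (p : Fin d → ℝ) (r : ℤ → Ω → ι → ℝ) : Prop where
  zmwssi : IsZMWSSI P μ p r
  uncorrelated : ∀ (w v : List (Fin d)) (t : ℤ), w ≠ [] → v ≠ [] → w ≠ v →
    crossMoment P (zProc μ p r w t) (zProc μ p r v t) = 0
  same_word : ∀ (σ : Fin d) (v : List (Fin d)) (t : ℤ), IsAdmissibleWord E (σ :: v) →
    crossMoment P (zProc μ p r (σ :: v) t) (zProc μ p r (σ :: v) t) =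
      crossMoment P (zProc μ p r [σ] t) (zProc μ p r [σ] t)
  nonsingular : ∀ (σ : Fin d) (t : ℤ),
    (crossMoment P (zProc μ p r [σ] t) (zProc μ p r [σ] t)).det ≠ 0

/-! ## Generalized linear switched systems -/

/-- The matrices of a GLSS with `d` modes, state dimension `n`, input dimension `nu`, output
dimension `ny` and noise dimension `nv`. -/
structure GLSS (d n nu ny nv : ℕ) where
  A : Fin d → Matrix (Fin n) (Fin n) ℝ
  B : Fin d → Matrix (Fin n) (Fin nu) ℝ
  K : Fin d → Matrix (Fin n) (Fin nv) ℝ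
  C : Matrix (Fin ny) (Fin n) ℝ
  D : Matrix (Fin ny) (Fin nu) ℝ
  F : Matrix (Fin ny) (Fin nv) ℝ

/-- `(S, v)` with state process `x` is a stationary GLSS of `(y, u, μ)`. The noise is
uncorrelated with the simultaneous state and with the past states (`cross_same`,
`cross_past`). -/
structure IsSGLSSWithState {Ω : Type*} [MeasurableSpace Ω] (P : Measure Ω) {d n nu ny nv : ℕ}
    (μ : ℤ → Ω → Fin d → ℝ) (E : Fin d → Fin d → Prop) (p : Fin d → ℝ)
    (y : ℤ → Ω → Fin ny → ℝ) (u : ℤ → Ω → Fin nu → ℝ)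
    (S : GLSS d n nu ny nv) (v : ℤ → Ω → Fin nv → ℝ) (x : ℤ → Ω → Fin n → ℝ) : Prop where
  measurable_output : ∀ t, Measurable (y t)
  state_eq : ∀ t, ∀ᵐ ω ∂P, x (t + 1) ω = ∑ σ, μ t ω σ •
    ((S.A σ).mulVec (x t ω) + (S.B σ).mulVec (u t ω) + (S.K σ).mulVec (v t ω))
  output_eq : ∀ t, ∀ᵐ ω ∂P,
    y t ω = S.C.mulVec (x t ω) + S.D.mulVec (u t ω) + S.F.mulVec (v t ω)
  whiteNoise : IsWhiteNoise P μ E p (stack v u)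
  zmwssi : IsZMWSSI P μ p (stack x (stack v u))
  cross_same : ∀ (σ : Fin d) (t : ℤ),
    crossMoment P (zProc μ p x [σ] t) (zProc μ p (stack v u) [σ] t) = 0
  cross_past : ∀ (w : List (Fin d)) (t : ℤ), w ≠ [] →
    crossMoment P (zProc μ p x w t) (stack v u t) = 0
  stable : ∀ z ∈ spectrum ℂ
    ((∑ σ, p σ • Matrix.kronecker (S.A σ) (S.A σ)).map (algebraMap ℝ ℂ)), ‖z‖ < 1
  edge_A : ∀ σ₁ σ₂, ¬ E σ₁ σ₂ → S.A σ₂ * S.A σ₁ = 0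
  edge_KB : ∀ σ₁ σ₂, ¬ E σ₁ σ₂ → ∀ t, S.A σ₂ * Matrix.fromCols (S.K σ₁) (S.B σ₁) *
    crossMoment P (zProc μ p (stack v u) [σ₁] t) (zProc μ p (stack v u) [σ₁] t) = 0

/-- `(S, v)` is a stationary GLSS (sGLSS) of `(y, u, μ)`. -/
def IsSGLSS {Ω : Type*} [MeasurableSpace Ω] (P : Measure Ω) {d n nu ny nv : ℕ}
    (μ : ℤ → Ω → Fin d → ℝ) (E : Fin d → Fin d → Prop) (p : Fin d → ℝ)
    (y : ℤ → Ω → Fin ny → ℝ) (u : ℤ → Ω → Fin nu → ℝ)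
    (S : GLSS d n nu ny nv) (v : ℤ → Ω → Fin nv → ℝ) : Prop :=
  ∃ x : ℤ → Ω → Fin n → ℝ, IsSGLSSWithState P μ E p y u S v x

/-! ## Linear prediction, stochastic component and innovation process -/

open Classical in
/-- A square integrable random variable as an element of the Hilbert space `L²(P)` (and `0` for
a function that is not square integrable). -/
def toL2 {Ω : Type*} [MeasurableSpace Ω] (P : Measure Ω) (f : Ω → ℝ) : Lp ℝ 2 P :=
  if h : MemLp f 2 P then h.toLp f else 0

/-- The closed subspace of `L²(P)` generated by the random variables in `G`. -/
def closedSpan {Ω : Type*} [MeasurableSpace Ω] (P : Measure Ω) (G : Set (Ω → ℝ)) :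
    Submodule ℝ (Lp ℝ 2 P) :=
  (Submodule.span ℝ (toL2 P '' G)).topologicalClosure

instance closedSpan_hasOrthogonalProjection {Ω : Type*} [MeasurableSpace Ω] (P : Measure Ω)
    (G : Set (Ω → ℝ)) : (closedSpan P G).HasOrthogonalProjection :=
  haveI : CompleteSpace (closedSpan P G) :=
    (Submodule.isClosed_topologicalClosure _).completeSpace_coe
  inferInstance

/-- `E_l[f | G]`: the coordinatewise orthogonal projection of `f` onto the closed subspace
generated by `G`. -/
def linProj {Ω ι : Type*} [MeasurableSpace Ω] (P : Measure Ω) (G : Set (Ω → ℝ))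
    (f : Ω → ι → ℝ) (ω : Ω) (i : ι) : ℝ :=
  ((closedSpan P G).starProjection (toL2 P (fun ω' => f ω' i)) : Lp ℝ 2 P) ω

/-- The deterministic component `y^d(t) = E_l[y(t) | {z_w^u(t)}_{w ≠ ε} ∪ {u(t)}]`. -/
def detComponent {Ω ι κ : Type*} [MeasurableSpace Ω] (P : Measure Ω) {d : ℕ}
    (μ : ℤ → Ω → Fin d → ℝ) (p : Fin d → ℝ) (y : ℤ → Ω → ι → ℝ) (u : ℤ → Ω → κ → ℝ) :
    ℤ → Ω → ι → ℝ :=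
  fun t => linProj P
    ({f | ∃ (w : List (Fin d)) (i : κ), w ≠ [] ∧ f = fun ω => zProc μ p u w t ω i} ∪
      {f | ∃ i : κ, f = fun ω => u t ω i}) (y t)

/-- The stochastic component `y^s(t) = y(t) - y^d(t)`. -/
def stochComponent {Ω ι κ : Type*} [MeasurableSpace Ω] (P : Measure Ω) {d : ℕ}
    (μ : ℤ → Ω → Fin d → ℝ) (p : Fin d → ℝ) (y : ℤ → Ω → ι → ℝ) (u : ℤ → Ω → κ → ℝ) :
    ℤ → Ω → ι → ℝ :=
  fun t ω i => y t ω i - detComponent P μ p y u t ω i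

/-- The innovation `r(t) - E_l[r(t) | {z_w^r(t)}_{w ≠ ε}]` of a process `r`. -/
def innovation {Ω ι : Type*} [MeasurableSpace Ω] (P : Measure Ω) {d : ℕ}
    (μ : ℤ → Ω → Fin d → ℝ) (p : Fin d → ℝ) (r : ℤ → Ω → ι → ℝ) : ℤ → Ω → ι → ℝ :=
  fun t ω i => r t ω i - linProj P
    {f | ∃ (w : List (Fin d)) (j : ι), w ≠ [] ∧ f = fun ω => zProc μ p r w t ω j} (r t) ω i

/-- The process `e^s`, the innovation process of `y^s`. -/
def stochInnovation {Ω ι κ : Type*} [MeasurableSpace Ω] (P : Measure Ω) {d : ℕ}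
    (μ : ℤ → Ω → Fin d → ℝ) (p : Fin d → ℝ) (y : ℤ → Ω → ι → ℝ) (u : ℤ → Ω → κ → ℝ) :
    ℤ → Ω → ι → ℝ :=
  innovation P μ p (stochComponent P μ p y u)

/-- `(S, v)` is in innovation form: `F = I` and `v = e^s`. -/
def IsInnovationForm {Ω : Type*} [MeasurableSpace Ω] (P : Measure Ω) {d n nu ny : ℕ}
    (μ : ℤ → Ω → Fin d → ℝ) (p : Fin d → ℝ)
    (y : ℤ → Ω → Fin ny → ℝ) (u : ℤ → Ω → Fin nu → ℝ)
    (S : GLSS d n nu ny ny) (v : ℤ → Ω → Fin ny → ℝ) : Prop :=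
  S.F = 1 ∧ ∀ t, v t =ᵐ[P] stochInnovation P μ p y u t

/-! ## Reachability and observability of the stochastic part

The stochastic part `({A_σ, K_σ}, C, F, v)` of a system is a stationary generalized bilinear
system without input. Its state process `x` has switched covariances
`X_σ = E[x(t) x(t)ᵀ μ_σ(t)²]`, determined by `A_σ`, `K_σ` and the noise covariances
`Q_σ = E[v(t) v(t)ᵀ μ_σ(t)²]`; its output `y` satisfies
`E[x(t) z_σ^y(t)ᵀ] = p_σ^(-1/2) (A_σ X_σ Cᵀ + K_σ Q_σ Fᵀ)`. The system is reachable if the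
columns of the products of the `A_w` with these matrices span the state space. -/

open Classical in
/-- `X` solves the Lyapunov equations satisfied by the switched covariances of the state; the
solution exists and is unique for a stationary GLSS. -/
def IsStateCovariance {d n nu ny nv : ℕ} (E : Fin d → Fin d → Prop) (p : Fin d → ℝ)
    (S : GLSS d n nu ny nv) (Q : Fin d → Matrix (Fin nv) (Fin nv) ℝ)
    (X : Fin d → Matrix (Fin n) (Fin n) ℝ) : Prop :=
  ∀ σ, X σ = p σ • ∑ σ', if E σ' σ then
    S.A σ' * X σ' * (S.A σ').transpose + S.K σ' * Q σ' * (S.K σ').transpose else 0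

/-- The matrix `p_σ^(-1/2) (A_σ X_σ Cᵀ + K_σ Q_σ Fᵀ)`. -/
def stateOutputCov {d n nu ny nv : ℕ} (p : Fin d → ℝ)
    (S : GLSS d n nu ny nv) (Q : Fin d → Matrix (Fin nv) (Fin nv) ℝ)
    (X : Fin d → Matrix (Fin n) (Fin n) ℝ) (σ : Fin d) : Matrix (Fin n) (Fin ny) ℝ :=
  (1 / Real.sqrt (p σ)) •
    (S.A σ * X σ * S.C.transpose + S.K σ * Q σ * S.F.transpose)

/-- The stochastic part of `(S, v)` is reachable as a stationary generalized bilinear system. -/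
def IsStochReachable {Ω : Type*} [MeasurableSpace Ω] (P : Measure Ω) {d n nu ny nv : ℕ}
    (μ : ℤ → Ω → Fin d → ℝ) (E : Fin d → Fin d → Prop) (p : Fin d → ℝ)
    (S : GLSS d n nu ny nv) (v : ℤ → Ω → Fin nv → ℝ) : Prop :=
  ∃ X, IsStateCovariance E p S (fun σ => switchedCov P μ v σ 0) X ∧
    Submodule.span ℝ {ξ : Fin n → ℝ | ∃ (w : List (Fin d)) (σ : Fin d) (η : Fin ny → ℝ),
      ξ = (wordProd S.A w *
        stateOutputCov p S (fun σ => switchedCov P μ v σ 0) X σ).mulVec η} = ⊤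

/-- The stochastic part of `S` is observable: `⋂_w ker (C A_w) = 0`. -/
def IsStochObservable {d n nu ny nv : ℕ} (S : GLSS d n nu ny nv) : Prop :=
  ∀ ξ : Fin n → ℝ, (∀ w : List (Fin d), (S.C * wordProd S.A w).mulVec ξ = 0) → ξ = 0

end

/-! ### Conditional independence and integration against conditional expectations. -/

section ConditionalIndependence

variable {Ω : Type*} {m m₁ m₂ m₀ : MeasurableSpace Ω} {P : Measure Ω}

/-! The probabilistic statement reduces to a fact of realization theory: reachable and observable
representations with equal Markov parameters are isomorphic (`exists_isomorphism_of_markov_eq`).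
Noise and input are treated together as one process `ω = [vᵀ, uᵀ]ᵀ` entering through `[K_σ, B_σ]`,
so a single `T` transports both blocks.

The Markov parameters `C A_w [K_τ, B_τ]` can be read off from second moments. By
`crossMoment_state_noise`, the correlation of the state with `z_{τw}^ω` is `√p_{τw} A_w [K_τ, B_τ]
Q_τ`, with `Q_τ` the nonsingular covariance of `z_τ^ω`. Two systems with the same noise, `D` and `F`
have the same `Cx = y - Du - Fv`, so multiplying by `C` and cancelling `Q_τ` equates the parameters
on admissible words. On the other words both sides vanish by the edge conditions.

The moment formula is an induction on the last letter. It needs the moments of products of `μ`,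
known only conditionally on the past of `μ`, to be usable next to factors depending on `x` and `ω`.
Conditional independence given that past permits this (`CondIndepSigma.integral_mul_condExp`).

Reachability is assumed for the state-output covariances, not for `[K_σ, B_σ]`. The state covariance
solves a stable Lyapunov equation, so its columns lie in the smallest `A`-invariant subspace
containing the columns of the `K_σ`. That subspace is therefore everything, and adding the columns
of `B_σ` keeps it so. -/

theorem setIntegral_eq_zero_of_measurableSet_sup (hm : m ≤ m₀)
    (hm₂ : m₂ ≤ m₀) {g : Ω → ℝ} (hg : Integrable g P)
    (h : ∀ M B : Set Ω, MeasurableSet[m] M → MeasurableSet[m₂] B → ∫ ω in M ∩ B, g ω ∂P = 0)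
    {s : Set Ω} (hs : MeasurableSet[m ⊔ m₂] s) : ∫ ω in s, g ω ∂P = 0 := by
  have hsup : m ⊔ m₂ ≤ m₀ := sup_le hm hm₂
  -- The intersections `M ∩ B` form a π-system generating `m ⊔ m₂`, so Dynkin's π-λ argument
  -- applies.
  have hgen : m ⊔ m₂ = MeasurableSpace.generateFrom
      {s | ∃ M B : Set Ω, MeasurableSet[m] M ∧ MeasurableSet[m₂] B ∧ s = M ∩ B} := by
    apply le_antisymm
    · refine sup_le (fun s hs => ?_) (fun s hs => ?_)
      · exact MeasurableSpace.measurableSet_generateFrom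
          ⟨s, Set.univ, hs, @MeasurableSet.univ _ m₂, by simp⟩
      · exact MeasurableSpace.measurableSet_generateFrom
          ⟨Set.univ, s, @MeasurableSet.univ _ m, hs, by simp⟩
    · refine MeasurableSpace.generateFrom_le ?_
      rintro _ ⟨M, B, hM, hB, rfl⟩
      exact @MeasurableSet.inter _ (m ⊔ m₂) _ _ ((le_sup_left : m ≤ m ⊔ m₂) _ hM)
        ((le_sup_right : m₂ ≤ m ⊔ m₂) _ hB)
  refine MeasurableSpace.induction_on_inter (m := m ⊔ m₂)
    (C := fun s _ => ∫ ω in s, g ω ∂P = 0) hgen ?_ ?_ ?_ ?_ ?_ s hs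
  · rintro _ ⟨M, B, hM, hB, rfl⟩ _ ⟨M', B', hM', hB', rfl⟩ _
    exact ⟨M ∩ M', B ∩ B', @MeasurableSet.inter _ m _ _ hM hM',
      @MeasurableSet.inter _ m₂ _ _ hB hB', by ext; simp; tauto⟩
  · simp
  · rintro _ ⟨M, B, hM, hB, rfl⟩
    exact h M B hM hB
  · intro t ht h0
    have huniv : ∫ ω, g ω ∂P = 0 := by
      simpa using h Set.univ Set.univ (@MeasurableSet.univ _ m) (@MeasurableSet.univ _ m₂)
    have := integral_add_compl (hsup _ ht) hg
    linarith
  · intro f hd hf h0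
    rw [integral_iUnion (fun i => hsup _ (hf i)) hd hg.integrableOn]
    simp [h0]

theorem norm_condExp_indicator_one_le (A : Set Ω) :
    ∀ᵐ ω ∂P, ‖(P[A.indicator (fun _ => (1 : ℝ)) | m]) ω‖ ≤ 1 := by
  have := ae_bdd_abs_condExp_of_ae_bdd_abs (m := m) (μ := P) (R := 1)
    (f := A.indicator (fun _ => (1 : ℝ))) (ae_of_all _ fun ω => by
      by_cases h : ω ∈ A <;> simp [h])
  simpa using this

variable [IsProbabilityMeasure P]

/-- Once `m` is known, `m₂` carries no further information on events of `m₁`. It suffices to compare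
integrals over sets `M ∩ B`; conditioning on `m` there turns the comparison into the product
formula. -/
theorem CondIndepSigma.condExp_indicator_sup (h : CondIndepSigma P m m₁ m₂) (hm : m ≤ m₀)
    (hm₁ : m₁ ≤ m₀) (hm₂ : m₂ ≤ m₀) {A : Set Ω} (hA : MeasurableSet[m₁] A) :
    P[A.indicator (fun _ => (1 : ℝ)) | m] =ᵐ[P]
      P[A.indicator (fun _ => (1 : ℝ)) | m ⊔ m₂] := by
  have hind : ∀ S : Set Ω, MeasurableSet S → Integrable (S.indicator (fun _ => (1 : ℝ))) P :=
    fun S hS => (integrable_const 1).indicator hS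
  have hmeas : StronglyMeasurable[m ⊔ m₂] (P[A.indicator (fun _ => (1 : ℝ)) | m]) :=
    StronglyMeasurable.mono (m' := m) stronglyMeasurable_condExp le_sup_left
  refine ae_eq_condExp_of_forall_setIntegral_eq (sup_le hm hm₂) (hind A (hm₁ _ hA))
    (fun _ _ _ => integrable_condExp.integrableOn) (fun s hs _ => ?_)
    hmeas.aestronglyMeasurable
  rw [← sub_eq_zero, ← integral_sub integrable_condExp.integrableOn
    (hind A (hm₁ _ hA)).integrableOn]
  refine setIntegral_eq_zero_of_measurableSet_sup hm hm₂
    (integrable_condExp.sub (hind A (hm₁ _ hA))) (fun M B hM hB => ?_) hs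
  have hB' := hm₂ _ hB
  rw [integral_sub' integrable_condExp.integrableOn (hind A (hm₁ _ hA)).integrableOn, sub_eq_zero,
    ← setIntegral_indicator hB', ← setIntegral_indicator hB']
  have hprod : ∀ f : Ω → ℝ, B.indicator f = f * B.indicator (fun _ => (1 : ℝ)) := by
    intro f
    ext ω
    by_cases hω : ω ∈ B <;> simp [hω]
  have hint : Integrable (P[A.indicator (fun _ => (1 : ℝ)) | m] *
      B.indicator (fun _ => (1 : ℝ))) P := by
    rw [← hprod]
    exact integrable_condExp.indicator hB'
  have hpull := condExp_mul_of_stronglyMeasurable_left (μ := P)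
    (stronglyMeasurable_condExp (m := m) (f := A.indicator (fun _ => (1 : ℝ))) (μ := P)) hint
    (hind B hB')
  have hinter : B.indicator (A.indicator (fun _ => (1 : ℝ))) =
      (A ∩ B).indicator (fun _ => (1 : ℝ)) := by
    rw [Set.indicator_indicator, Set.inter_comm]
  rw [hinter, hprod, ← setIntegral_condExp hm hint hM,
    ← setIntegral_condExp hm (hind _ ((hm₁ _ hA).inter hB')) hM]
  refine setIntegral_congr_ae (hm _ hM) ?_
  filter_upwards [hpull, h A B hA hB] with ω h1 h2 _
  rw [h1, h2]
  rfl

/-- If `m₁` and `m₂` are conditionally independent given `m`, then `E[G | m]` may replace an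
`m ⊔ m₂`-measurable `G` when integrated over sets of `m₁`. -/
theorem CondIndepSigma.setIntegral_condExp (h : CondIndepSigma P m m₁ m₂) (hm : m ≤ m₀)
    (hm₁ : m₁ ≤ m₀) (hm₂ : m₂ ≤ m₀) {G : Ω → ℝ} (hG : StronglyMeasurable[m ⊔ m₂] G)
    (hGi : Integrable G P) {A : Set Ω} (hA : MeasurableSet[m₁] A) :
    ∫ ω in A, (P[G | m]) ω ∂P = ∫ ω in A, G ω ∂P := by
  have hsup : m ⊔ m₂ ≤ m₀ := sup_le hm hm₂
  have hA' := hm₁ _ hA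
  have hAi : Integrable (A.indicator (fun _ => (1 : ℝ))) P := (integrable_const 1).indicator hA'
  have hprod : ∀ f : Ω → ℝ, A.indicator f = A.indicator (fun _ => (1 : ℝ)) * f := by
    intro f
    ext ω
    by_cases hω : ω ∈ A <;> simp [hω]
  have hbd := norm_condExp_indicator_one_le (P := P) (m := m) A
  have hφm : AEStronglyMeasurable (P[A.indicator (fun _ => (1 : ℝ)) | m]) P :=
    (stronglyMeasurable_condExp.mono hm).aestronglyMeasurable
  have hint : ∀ {f : Ω → ℝ}, Integrable f P → Integrable (A.indicator (fun _ => (1 : ℝ)) * f) P := by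
    intro f hf
    rw [← hprod]
    exact hf.indicator hA'
  -- Both integrals over `A` equal `∫ P(A | m) G`: in `e1` the indicator is conditioned on `m ⊔ m₂`,
  -- for which `G` is measurable; in `e2` and `e3` everything is conditioned on `m`.
  have e1 : ∫ ω in A, G ω ∂P = ∫ ω, (P[A.indicator (fun _ => (1 : ℝ)) | m]) ω * G ω ∂P := by
    rw [← integral_indicator hA', hprod, ← integral_condExp hsup]
    refine integral_congr_ae ?_
    filter_upwards [condExp_mul_of_stronglyMeasurable_right hG (hint hGi) hAi,
      h.condExp_indicator_sup hm hm₁ hm₂ hA] with ω h1 h2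
    rw [h1, h2]
    rfl
  have e2 : ∫ ω, (P[A.indicator (fun _ => (1 : ℝ)) | m]) ω * G ω ∂P =
      ∫ ω, (P[A.indicator (fun _ => (1 : ℝ)) | m]) ω * (P[G | m]) ω ∂P := by
    have hi : Integrable (P[A.indicator (fun _ => (1 : ℝ)) | m] * G) P :=
      hGi.bdd_mul hφm hbd
    rw [← integral_condExp (f := fun ω => (P[A.indicator (fun _ => (1 : ℝ)) | m]) ω * G ω) hm]
    exact integral_congr_ae
      (condExp_mul_of_stronglyMeasurable_left stronglyMeasurable_condExp hi hGi)
  have e3 : ∫ ω in A, (P[G | m]) ω ∂P =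
      ∫ ω, (P[A.indicator (fun _ => (1 : ℝ)) | m]) ω * (P[G | m]) ω ∂P := by
    rw [← integral_indicator hA', hprod, ← integral_condExp hm]
    exact integral_congr_ae (condExp_mul_of_stronglyMeasurable_right
      stronglyMeasurable_condExp (hint integrable_condExp) hAi)
  rw [e3, e1, e2]

/-- `G` and `H` have equal integrals over the sets of `m₁`, so `E[G - H | m₁] = 0`, and pulling out
the `m₁`-measurable `f` finishes. Integrability is required of the products only, since `f` will be
a product of two values of a process and need not be bounded. -/
theorem CondIndepSigma.integral_mul_condExp (h : CondIndepSigma P m m₁ m₂) (hm : m ≤ m₀)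
    (hm₁ : m₁ ≤ m₀) (hm₂ : m₂ ≤ m₀) {f G H : Ω → ℝ} (hf : StronglyMeasurable[m₁] f)
    (hG : StronglyMeasurable[m ⊔ m₂] G) (hGi : Integrable G P) (hGH : P[G | m] =ᵐ[P] H)
    (hfG : Integrable (fun ω => f ω * G ω) P) (hfH : Integrable (fun ω => f ω * H ω) P) :
    ∫ ω, f ω * G ω ∂P = ∫ ω, f ω * H ω ∂P := by
  have hHi : Integrable H P := integrable_condExp.congr hGH
  have h0 : P[fun ω => G ω - H ω | m₁] =ᵐ[P] 0 := by
    symm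
    refine ae_eq_condExp_of_forall_setIntegral_eq hm₁ (hGi.sub hHi) (fun _ _ _ => by
      exact (integrable_zero Ω ℝ P).integrableOn) (fun s hs _ => ?_)
      aestronglyMeasurable_zero
    rw [integral_sub hGi.integrableOn hHi.integrableOn,
      ← h.setIntegral_condExp hm hm₁ hm₂ hG hGi hs,
      setIntegral_congr_ae (hm₁ _ hs) (hGH.mono fun ω hω _ => hω)]
    simp
  have hi : Integrable (f * fun ω => G ω - H ω) P :=
    (hfG.sub hfH).congr (ae_of_all _ fun ω => by simp [mul_sub])
  rw [← sub_eq_zero, ← integral_sub hfG hfH]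
  have e := condExp_mul_of_stronglyMeasurable_left hf hi (hGi.sub hHi)
  calc ∫ ω, f ω * G ω - f ω * H ω ∂P = ∫ ω, (f * fun ω => G ω - H ω) ω ∂P := by
        simp [mul_sub]
    _ = ∫ ω, (P[f * fun ω => G ω - H ω | m₁]) ω ∂P := (integral_condExp hm₁).symm
    _ = ∫ ω, (0 : ℝ) ∂P := by
        refine integral_congr_ae ?_
        filter_upwards [e, h0] with ω h1 h2
        rw [h1]
        simp only [Pi.mul_apply]
        erw [h2]
        simp
    _ = 0 := by simp

end ConditionalIndependence

/-! ### Linear representations: reachability, observability, uniqueness. -/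

section Realization

variable {d : ℕ} {n nh : ℕ} {κ : Type*}

theorem wordProd_concat (A : Fin d → Matrix (Fin n) (Fin n) ℝ) (w : List (Fin d)) (σ : Fin d) :
    wordProd A (w ++ [σ]) = A σ * wordProd A w := by
  induction w with
  | nil => simp [wordProd]
  | cons τ w ih => simp [wordProd, ih, Matrix.mul_assoc]

theorem wordProd_append (A : Fin d → Matrix (Fin n) (Fin n) ℝ) (w v : List (Fin d)) :
    wordProd A (w ++ v) = wordProd A v * wordProd A w := by
  induction w with
  | nil => simp [wordProd]
  | cons τ w ih => simp [wordProd, ih, Matrix.mul_assoc]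

theorem wordProd_eq_zero_of_not_isChain {E : Fin d → Fin d → Prop}
    {A : Fin d → Matrix (Fin n) (Fin n) ℝ} (hA : ∀ σ τ, ¬ E σ τ → A τ * A σ = 0)
    {w : List (Fin d)} (hw : ¬ w.IsChain E) : wordProd A w = 0 := by
  induction w with
  | nil => simp at hw
  | cons σ w ih =>
    cases w with
    | nil => simp at hw
    | cons τ w =>
      rw [List.isChain_cons_cons, not_and_or] at hw
      rcases hw with h | h
      · simp [wordProd, Matrix.mul_assoc, hA σ τ h]
      · rw [wordProd, ih h, Matrix.zero_mul]

theorem wordProd_mul_eq_zero_of_not_isChain {E : Fin d → Fin d → Prop}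
    {A : Fin d → Matrix (Fin n) (Fin n) ℝ} {B : Fin d → Matrix (Fin n) κ ℝ}
    (hA : ∀ σ τ, ¬ E σ τ → A τ * A σ = 0) (hB : ∀ σ τ, ¬ E σ τ → A τ * B σ = 0)
    {σ : Fin d} {w : List (Fin d)} (hw : ¬ (σ :: w).IsChain E) : wordProd A w * B σ = 0 := by
  cases w with
  | nil => simp at hw
  | cons τ w =>
    rw [List.isChain_cons_cons, not_and_or] at hw
    rcases hw with h | h
    · simp [wordProd, Matrix.mul_assoc, hB σ τ h]
    · rw [wordProd_eq_zero_of_not_isChain hA h, Matrix.zero_mul]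

variable [Fintype κ]

/-- The span of the columns of all matrices `A_w B_σ`. -/
def reachableSpace (A : Fin d → Matrix (Fin n) (Fin n) ℝ) (B : Fin d → Matrix (Fin n) κ ℝ) :
    Submodule ℝ (Fin n → ℝ) :=
  Submodule.span ℝ {ξ | ∃ (w : List (Fin d)) (σ : Fin d) (η : κ → ℝ),
    ξ = (wordProd A w * B σ).mulVec η}

theorem mulVec_mem_reachableSpace (A : Fin d → Matrix (Fin n) (Fin n) ℝ)
    (B : Fin d → Matrix (Fin n) κ ℝ) (σ : Fin d) {ξ : Fin n → ℝ} (hξ : ξ ∈ reachableSpace A B) :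
    (A σ).mulVec ξ ∈ reachableSpace A B := by
  have : reachableSpace A B ≤ (reachableSpace A B).comap (A σ).mulVecLin := by
    refine Submodule.span_le.2 ?_
    rintro _ ⟨w, τ, η, rfl⟩
    refine Submodule.subset_span ⟨w ++ [σ], τ, η, ?_⟩
    simp [wordProd_concat, Matrix.mul_assoc]
  exact this hξ

theorem wordProd_mulVec_mem_reachableSpace (A : Fin d → Matrix (Fin n) (Fin n) ℝ)
    (B : Fin d → Matrix (Fin n) κ ℝ) (w : List (Fin d)) {ξ : Fin n → ℝ}
    (hξ : ξ ∈ reachableSpace A B) : (wordProd A w).mulVec ξ ∈ reachableSpace A B := by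
  induction w generalizing ξ with
  | nil => simpa [wordProd]
  | cons σ w ih =>
    rw [wordProd, ← Matrix.mulVec_mulVec]
    exact ih (mulVec_mem_reachableSpace A B σ hξ)

theorem input_mulVec_mem_reachableSpace (A : Fin d → Matrix (Fin n) (Fin n) ℝ)
    (B : Fin d → Matrix (Fin n) κ ℝ) (σ : Fin d) (η : κ → ℝ) :
    (B σ).mulVec η ∈ reachableSpace A B :=
  Submodule.subset_span ⟨[], σ, η, by simp [wordProd]⟩

/-- The reachable space is the smallest `A`-invariant subspace containing the input columns. -/
theorem reachableSpace_le {κ' : Type*} [Fintype κ'] (A : Fin d → Matrix (Fin n) (Fin n) ℝ)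
    (B : Fin d → Matrix (Fin n) κ ℝ) (G : Fin d → Matrix (Fin n) κ' ℝ)
    (h : ∀ σ η, (G σ).mulVec η ∈ reachableSpace A B) : reachableSpace A G ≤ reachableSpace A B := by
  refine Submodule.span_le.2 ?_
  rintro _ ⟨w, σ, η, rfl⟩
  rw [← Matrix.mulVec_mulVec]
  exact wordProd_mulVec_mem_reachableSpace A B w (h σ η)

/-- Two reachable and observable linear representations with the same Markov parameters are
isomorphic. -/
theorem exists_isomorphism_of_markov_eq {ny : ℕ} (A : Fin d → Matrix (Fin n) (Fin n) ℝ)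
    (B : Fin d → Matrix (Fin n) κ ℝ) (C : Matrix (Fin ny) (Fin n) ℝ)
    (Ah : Fin d → Matrix (Fin nh) (Fin nh) ℝ)
    (Bh : Fin d → Matrix (Fin nh) κ ℝ) (Ch : Matrix (Fin ny) (Fin nh) ℝ)
    (hr : reachableSpace A B = ⊤) (hrh : reachableSpace Ah Bh = ⊤)
    (ho : ∀ ξ : Fin n → ℝ, (∀ w, (C * wordProd A w).mulVec ξ = 0) → ξ = 0)
    (hoh : ∀ ξ : Fin nh → ℝ, (∀ w, (Ch * wordProd Ah w).mulVec ξ = 0) → ξ = 0)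
    (hM : ∀ w σ, C * wordProd A w * B σ = Ch * wordProd Ah w * Bh σ) :
    ∃ (T : Matrix (Fin nh) (Fin n) ℝ) (Tinv : Matrix (Fin n) (Fin nh) ℝ),
      T * Tinv = 1 ∧ Tinv * T = 1 ∧ (∀ σ, T * A σ * Tinv = Ah σ ∧ T * B σ = Bh σ) ∧
      C * Tinv = Ch := by
  classical
  -- The graph of the isomorphism to be found: it must pair the vectors reached by the same word,
  -- letter and input.
  let Γ : Submodule ℝ ((Fin n → ℝ) × (Fin nh → ℝ)) :=
    Submodule.span ℝ {ξ | ∃ (w : List (Fin d)) (σ : Fin d) (η : κ → ℝ),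
      ξ = ((wordProd A w * B σ).mulVec η, (wordProd Ah w * Bh σ).mulVec η)}
  have hout : ∀ ξ ∈ Γ, ∀ w, (C * wordProd A w).mulVec ξ.1 = (Ch * wordProd Ah w).mulVec ξ.2 := by
    intro ξ hξ w
    have : Γ ≤ LinearMap.eqLocus
        ((C * wordProd A w).mulVecLin ∘ₗ LinearMap.fst ℝ (Fin n → ℝ) (Fin nh → ℝ))
        ((Ch * wordProd Ah w).mulVecLin ∘ₗ LinearMap.snd ℝ (Fin n → ℝ) (Fin nh → ℝ)) := by
      refine Submodule.span_le.2 ?_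
      rintro _ ⟨w', σ, η, rfl⟩
      -- Reading the output after `w` from a vector reached by `w'` gives the Markov parameter of
      -- the concatenated word.
      have e := hM (w' ++ w) σ
      rw [wordProd_append, wordProd_append] at e
      have e' := congrArg (fun M => M.mulVec η) e
      simpa [LinearMap.mem_eqLocus, Matrix.mul_assoc] using e'
    exact this hξ
  have hinv : ∀ ξ ∈ Γ, ∀ σ, ((A σ).mulVec ξ.1, (Ah σ).mulVec ξ.2) ∈ Γ := by
    intro ξ hξ σ
    have : Γ ≤ Γ.comap ((A σ).mulVecLin.prodMap (Ah σ).mulVecLin) := by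
      refine Submodule.span_le.2 ?_
      rintro _ ⟨w, τ, η, rfl⟩
      refine Submodule.subset_span ⟨w ++ [σ], τ, η, ?_⟩
      simp [wordProd_concat, Matrix.mul_assoc]
    exact this hξ
  have hfst : Γ.map (LinearMap.fst ℝ _ _) = ⊤ := by
    rw [eq_top_iff, ← hr]
    refine Submodule.span_le.2 ?_
    rintro _ ⟨w, σ, η, rfl⟩
    exact ⟨_, Submodule.subset_span ⟨w, σ, η, rfl⟩, rfl⟩
  have hsnd : Γ.map (LinearMap.snd ℝ _ _) = ⊤ := by
    rw [eq_top_iff, ← hrh]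
    refine Submodule.span_le.2 ?_
    rintro _ ⟨w, σ, η, rfl⟩
    exact ⟨_, Submodule.subset_span ⟨w, σ, η, rfl⟩, rfl⟩
  let f : Γ →ₗ[ℝ] (Fin n → ℝ) := LinearMap.fst ℝ _ _ ∘ₗ Γ.subtype
  let g : Γ →ₗ[ℝ] (Fin nh → ℝ) := LinearMap.snd ℝ _ _ ∘ₗ Γ.subtype
  -- A pair in `Γ` with first entry `0` has zero outputs, so its second entry vanishes by
  -- observability; surjectivity is reachability. The other projection is symmetric.
  have hf : Function.Bijective f := by
    constructor
    · refine (injective_iff_map_eq_zero f).2 fun ξ hξ => Subtype.ext (Prod.ext hξ ?_)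
      refine hoh _ fun w => ?_
      rw [← hout ξ ξ.2 w, show (ξ : (Fin n → ℝ) × (Fin nh → ℝ)).1 = 0 from hξ, Matrix.mulVec_zero]
    · intro a
      obtain ⟨ξ, hξ, rfl⟩ : a ∈ Γ.map (LinearMap.fst ℝ _ _) := hfst ▸ Submodule.mem_top
      exact ⟨⟨ξ, hξ⟩, rfl⟩
  have hg : Function.Bijective g := by
    constructor
    · refine (injective_iff_map_eq_zero g).2 fun ξ hξ => Subtype.ext (Prod.ext ?_ hξ)
      refine ho _ fun w => ?_
      rw [hout ξ ξ.2 w, show (ξ : (Fin n → ℝ) × (Fin nh → ℝ)).2 = 0 from hξ, Matrix.mulVec_zero]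
    · intro a
      obtain ⟨ξ, hξ, rfl⟩ : a ∈ Γ.map (LinearMap.snd ℝ _ _) := hsnd ▸ Submodule.mem_top
      exact ⟨⟨ξ, hξ⟩, rfl⟩
  let e : (Fin n → ℝ) ≃ₗ[ℝ] (Fin nh → ℝ) :=
    (LinearEquiv.ofBijective f hf).symm.trans (LinearEquiv.ofBijective g hg)
  have he : ∀ ξ ∈ Γ, e ξ.1 = ξ.2 := by
    intro ξ hξ
    have h1 : (LinearEquiv.ofBijective f hf) ⟨ξ, hξ⟩ = ξ.1 := rfl
    rw [← h1]
    simp only [e, LinearEquiv.trans_apply, LinearEquiv.symm_apply_apply]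
    rfl
  have hmem : ∀ a, (a, e a) ∈ Γ := by
    intro a
    obtain ⟨ξ, rfl⟩ := hf.2 a
    rw [show e (f ξ) = (ξ : (Fin n → ℝ) × (Fin nh → ℝ)).2 from he ξ ξ.2]
    exact ξ.2
  have hT : ∀ a, (LinearMap.toMatrix' e.toLinearMap).mulVec a = e a := fun a => by
    rw [LinearMap.toMatrix'_mulVec]; rfl
  have hT' : ∀ a, (LinearMap.toMatrix' e.symm.toLinearMap).mulVec a = e.symm a := fun a => by
    rw [LinearMap.toMatrix'_mulVec]; rfl
  refine ⟨LinearMap.toMatrix' e.toLinearMap, LinearMap.toMatrix' e.symm.toLinearMap,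
    ?_, ?_, fun σ => ⟨?_, ?_⟩, ?_⟩
  · rw [← LinearMap.toMatrix'_comp]; simp
  · rw [← LinearMap.toMatrix'_comp]; simp
  · refine Matrix.ext_of_mulVec_single fun i => ?_
    rw [← Matrix.mulVec_mulVec, ← Matrix.mulVec_mulVec, hT', hT]
    have := he _ (hinv _ (hmem (e.symm (Pi.single i 1))) σ)
    simpa using this
  · refine Matrix.ext_of_mulVec_single fun i => ?_
    rw [← Matrix.mulVec_mulVec, hT]
    refine he ((B σ).mulVec (Pi.single i 1), (Bh σ).mulVec (Pi.single i 1))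
      (Submodule.subset_span ⟨[], σ, Pi.single i 1, ?_⟩)
    simp [wordProd]
  · refine Matrix.ext_of_mulVec_single fun i => ?_
    rw [← Matrix.mulVec_mulVec, hT']
    have := hout _ (hmem (e.symm (Pi.single i 1))) []
    simpa [wordProd] using this

end Realization

/-! ### Stable Lyapunov equations and invariant subspaces. -/

section Lyapunov

open Matrix

variable {ι : Type*} [Fintype ι] {n : ℕ}

/-- After vectorization, a nonzero solution would be an eigenvector of `∑ p A ⊗ A` with eigenvalue
`1`, outside the open unit disc. -/
theorem eq_zero_of_lyapunov_homogeneous (p : ι → ℝ) (A : ι → Matrix (Fin n) (Fin n) ℝ)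
    (hA : ∀ z ∈ spectrum ℂ ((∑ σ, p σ • kronecker (A σ) (A σ)).map (algebraMap ℝ ℂ)), ‖z‖ < 1)
    {Z : Matrix (Fin n) (Fin n) ℝ} (hZ : Z = ∑ σ, p σ • (A σ * Z * (A σ)ᵀ)) : Z = 0 := by
  set M := ∑ σ, p σ • kronecker (A σ) (A σ) with hM
  have hvec : M.mulVec (vec Z) = vec Z := by
    conv_rhs => rw [hZ]
    rw [hM, sum_mulVec]
    have : ∀ σ, (p σ • kronecker (A σ) (A σ)).mulVec (vec Z) =
        vec (p σ • (A σ * Z * (A σ)ᵀ)) := fun σ => by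
      rw [smul_mulVec, vec_smul, ← kronecker_mulVec_vec]
      rfl
    simp only [this, vec_sum]
  by_contra hne
  have hdet : (1 - M).det = 0 := by
    refine exists_mulVec_eq_zero_iff.1 ⟨vec Z, fun h => hne (vec_eq_zero_iff.1 h), ?_⟩
    rw [sub_mulVec, one_mulVec, hvec, sub_self]
  have hspec : (1 : ℂ) ∈ spectrum ℂ (M.map (algebraMap ℝ ℂ)) := by
    rw [spectrum.mem_iff, isUnit_iff_isUnit_det, map_one]
    have : (1 - M.map (algebraMap ℝ ℂ)) = (algebraMap ℝ ℂ).mapMatrix (1 - M) := by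
      rw [map_sub, map_one]; rfl
    rw [this, ← RingHom.map_det, hdet, map_zero]
    simp
  simpa using hA 1 hspec

/-- A solution of the Lyapunov equation `Z = ∑ p A Z Aᵀ + W` has its columns in every subspace that
contains the columns of `W` and is invariant under the matrices `A`. -/
theorem mulVec_mem_of_lyapunov (p : ι → ℝ) (A : ι → Matrix (Fin n) (Fin n) ℝ)
    (hA : ∀ z ∈ spectrum ℂ ((∑ σ, p σ • kronecker (A σ) (A σ)).map (algebraMap ℝ ℂ)), ‖z‖ < 1)
    {Z W : Matrix (Fin n) (Fin n) ℝ} (hZ : Z = ∑ σ, p σ • (A σ * Z * (A σ)ᵀ) + W)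
    (R : Submodule ℝ (Fin n → ℝ)) (hR : ∀ σ, ∀ ξ ∈ R, (A σ).mulVec ξ ∈ R)
    (hW : ∀ η, W.mulVec η ∈ R) (η : Fin n → ℝ) : Z.mulVec η ∈ R := by
  -- `Φ` is injective by stability and preserves the space `U` of matrices with columns in `R`. By
  -- finite dimension it is onto `U`, so the unique solution for `W ∈ U` lies in `U`; no series
  -- expansion is needed.
  let Φ : Matrix (Fin n) (Fin n) ℝ →ₗ[ℝ] Matrix (Fin n) (Fin n) ℝ :=
    { toFun := fun X => X - ∑ σ, p σ • (A σ * X * (A σ)ᵀ)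
      map_add' := fun X Y => by
        simp only [Matrix.mul_add, Matrix.add_mul, smul_add, Finset.sum_add_distrib]
        abel
      map_smul' := fun c X => by
        simp only [Matrix.mul_smul, Matrix.smul_mul, RingHom.id_apply, smul_sub, Finset.smul_sum]
        congr 1
        exact Finset.sum_congr rfl fun σ _ => smul_comm _ _ _ }
  have hΦ : Function.Injective Φ := (injective_iff_map_eq_zero Φ).2 fun X hX =>
    eq_zero_of_lyapunov_homogeneous p A hA (sub_eq_zero.1 hX)
  let U : Submodule ℝ (Matrix (Fin n) (Fin n) ℝ) :=
    { carrier := {X | ∀ η, X.mulVec η ∈ R}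
      add_mem' := fun hX hY η => by
        rw [add_mulVec]; exact R.add_mem (hX η) (hY η)
      zero_mem' := fun η => by rw [zero_mulVec]; exact R.zero_mem
      smul_mem' := fun c X hX η => by rw [smul_mulVec]; exact R.smul_mem c (hX η) }
  have hU : ∀ X ∈ U, Φ X ∈ U := by
    intro X hX
    refine U.sub_mem hX (U.sum_mem fun σ _ => U.smul_mem _ fun η => ?_)
    rw [Matrix.mul_assoc, ← mulVec_mulVec, ← mulVec_mulVec]
    exact hR σ _ (hX _)
  have hinj : Function.Injective (Φ.restrict hU) := fun X Y h =>
    Subtype.ext (hΦ (congrArg Subtype.val h))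
  obtain ⟨Y, hY⟩ := (LinearMap.injective_iff_surjective.1 hinj) ⟨W, hW⟩
  have hYZ : (Y : Matrix (Fin n) (Fin n) ℝ) = Z := by
    refine hΦ ((congrArg Subtype.val hY).trans ?_)
    exact eq_sub_of_add_eq' hZ.symm
  rw [← hYZ]
  exact Y.2 η

end Lyapunov

/-- If the columns of the state-output covariances generate the state space, so do those of the
noise gains. -/
theorem reachableSpace_eq_top_of_stateOutputCov {d n nu ny nv : ℕ} {E : Fin d → Fin d → Prop}
    {p : Fin d → ℝ} {S : GLSS d n nu ny nv} {Q : Fin d → Matrix (Fin nv) (Fin nv) ℝ}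
    {X : Fin d → Matrix (Fin n) (Fin n) ℝ} (hX : IsStateCovariance E p S Q X)
    (hstable : ∀ z ∈ spectrum ℂ
      ((∑ σ, p σ • Matrix.kronecker (S.A σ) (S.A σ)).map (algebraMap ℝ ℂ)), ‖z‖ < 1)
    (hA : ∀ σ τ, ¬ E σ τ → S.A τ * S.A σ = 0) (hK : ∀ σ τ, ¬ E σ τ → S.A τ * S.K σ = 0)
    (hG : reachableSpace S.A (stateOutputCov p S Q X) = ⊤) : reachableSpace S.A S.K = ⊤ := by
  -- The sum runs over all letters, without the edge restriction. Left multiplication by `A_σ` kills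
  -- the terms of forbidden predecessors, so `A_σ X_σ = p_σ A_σ Z`, and the coupled equations for
  -- the `X_σ` collapse to one Lyapunov equation for `Z`.
  set Z := ∑ σ, (S.A σ * X σ * (S.A σ).transpose + S.K σ * Q σ * (S.K σ).transpose) with hZ
  have hAX : ∀ σ, S.A σ * X σ = p σ • (S.A σ * Z) := by
    intro σ
    conv_lhs => rw [hX σ]
    rw [Matrix.mul_smul, hZ, Matrix.mul_sum, Matrix.mul_sum]
    congr 1
    refine Finset.sum_congr rfl fun τ _ => ?_
    split_ifs with h
    · rfl
    · simp [Matrix.mul_add, ← Matrix.mul_assoc, hA τ σ h, hK τ σ h]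
  have hlyap : Z = ∑ σ, p σ • (S.A σ * Z * (S.A σ).transpose) +
      ∑ σ, S.K σ * Q σ * (S.K σ).transpose := by
    conv_lhs => rw [hZ, Finset.sum_add_distrib]
    simp only [hAX, Matrix.smul_mul]
  have hmem : ∀ η, Z.mulVec η ∈ reachableSpace S.A S.K := by
    refine mulVec_mem_of_lyapunov p S.A hstable hlyap _
      (fun σ ξ hξ => mulVec_mem_reachableSpace _ _ σ hξ) fun η => ?_
    rw [Matrix.sum_mulVec]
    refine Submodule.sum_mem _ fun σ _ => ?_
    rw [Matrix.mul_assoc, ← Matrix.mulVec_mulVec]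
    exact input_mulVec_mem_reachableSpace _ _ _ _
  rw [eq_top_iff, ← hG]
  refine reachableSpace_le _ _ _ fun σ η => ?_
  rw [stateOutputCov, hAX, Matrix.smul_mulVec, Matrix.add_mulVec, Matrix.smul_mul,
    Matrix.smul_mulVec, Matrix.mul_assoc, Matrix.mul_assoc, ← Matrix.mulVec_mulVec,
    ← Matrix.mulVec_mulVec, ← Matrix.mulVec_mulVec]
  exact Submodule.smul_mem _ _ (Submodule.add_mem _ (Submodule.smul_mem _ _
    (mulVec_mem_reachableSpace _ _ σ (hmem _))) (input_mulVec_mem_reachableSpace _ _ _ _))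

/-! ### Recursions and measurability for products of the switching process. -/

section SwitchingProducts

variable {Ω : Type*} {d : ℕ} {μ : ℤ → Ω → Fin d → ℝ} {p : Fin d → ℝ}

theorem switchProd_concat (w : List (Fin d)) (σ : Fin d) (t : ℤ) (ω : Ω) :
    switchProd μ (w ++ [σ]) t ω = switchProd μ w (t - 1) ω * μ t ω σ := by
  induction w with
  | nil => simp [switchProd]
  | cons τ w ih =>
    have : t - ((w.length : ℤ) + 1) = t - 1 - (w.length : ℤ) := by ring
    simp [switchProd, ih, mul_assoc, this]

theorem wordWeight_concat (w : List (Fin d)) (σ : Fin d) :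
    wordWeight p (w ++ [σ]) = wordWeight p w * p σ := by
  simp [wordWeight]

theorem wordWeight_pos (hp : ∀ σ, 0 < p σ) (w : List (Fin d)) : 0 < wordWeight p w :=
  List.prod_pos fun x hx => by
    obtain ⟨σ, _, rfl⟩ := List.mem_map.1 hx
    exact hp σ

theorem zProc_nil {ι : Type*} (r : ℤ → Ω → ι → ℝ) (t : ℤ) : zProc μ p r [] t = r t := by
  funext ω i
  simp [zProc, switchProd, wordWeight]

theorem zProc_singleton {ι : Type*} (r : ℤ → Ω → ι → ℝ) (σ : Fin d) (t : ℤ) (ω : Ω) (i : ι) :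
    zProc μ p r [σ] t ω i = r (t - 1) ω i * μ (t - 1) ω σ / √(p σ) := by
  simp [zProc, switchProd, wordWeight]

/-- The last letter is the most recent one, so deleting it is a step back in time by one unit; the
inductions over words rest on this. -/
theorem zProc_concat (hp : ∀ σ, 0 < p σ) {ι : Type*} (r : ℤ → Ω → ι → ℝ) (w : List (Fin d))
    (σ : Fin d) (t : ℤ) (ω : Ω) (i : ι) :
    zProc μ p r (w ++ [σ]) t ω i = zProc μ p r w (t - 1) ω i * μ (t - 1) ω σ / √(p σ) := by
  have : t - ((w.length : ℤ) + 1) = t - 1 - (w.length : ℤ) := by ring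
  simp only [zProc, switchProd_concat, wordWeight_concat,
    Real.sqrt_mul (wordWeight_pos hp w).le, List.length_append, List.length_singleton,
    Nat.cast_add, Nat.cast_one, this]
  ring

theorem measurable_sigmaBefore_apply {k t : ℤ} (h : k < t) (σ : Fin d) :
    Measurable[sigmaBefore μ t] fun ω => μ k ω σ :=
  (measurable_pi_apply σ).comp (measurable_iff_comap_le.2 (le_iSup₂_of_le k h le_rfl))

theorem measurable_sigmaFrom_apply {k t : ℤ} (h : t ≤ k) (σ : Fin d) :
    Measurable[sigmaFrom μ t] fun ω => μ k ω σ :=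
  (measurable_pi_apply σ).comp (measurable_iff_comap_le.2 (le_iSup₂_of_le k h le_rfl))

theorem measurable_sigmaUpTo_apply {ι : Type*} {r : ℤ → Ω → ι → ℝ} {k t : ℤ} (h : k ≤ t)
    (i : ι) : Measurable[sigmaUpTo r t] fun ω => r k ω i :=
  (measurable_pi_apply i).comp (measurable_iff_comap_le.2 (le_iSup₂_of_le k h le_rfl))

theorem measurable_switchProd (w : List (Fin d)) {s t : ℤ} (h : s < t) :
    Measurable[sigmaBefore μ t] (switchProd μ w s) := by
  induction w with
  | nil => exact @measurable_const _ _ _ (sigmaBefore μ t) 1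
  | cons σ w ih =>
    exact Measurable.mul (measurable_sigmaBefore_apply (by omega) σ) ih

end SwitchingProducts

/-! ### Second moments of the processes `z_w`. -/

section Moments

variable {Ω : Type*} [MeasurableSpace Ω] {P : Measure Ω} {d : ℕ}
  {μ : ℤ → Ω → Fin d → ℝ} {E : Fin d → Fin d → Prop} {p : Fin d → ℝ}
  {ι : Type*} {r : ℤ → Ω → ι → ℝ}

theorem IsZMWSSI.memLp_zProc (hr : IsZMWSSI P μ p r) (w : List (Fin d)) (t : ℤ) (i : ι) :
    MemLp (fun ω => zProc μ p r w t ω i) 2 P :=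
  hr.wss.1 (w, i) t

theorem IsAdmissibleSwitching.memLp_switchProd (hμ : IsAdmissibleSwitching P μ E p)
    {w : List (Fin d)} (hw : w ≠ []) (t : ℤ) : MemLp (switchProd μ w t) 2 P :=
  (hμ.wss w w hw hw).1 0 t

variable [IsProbabilityMeasure P]

/-- Replacing `μ_w μ_σ μ_τ` by its conditional expectation given the past of `μ` in the mixed
moments of `r`. -/
theorem IsZMWSSI.integral_zProc_mul_zProc (hμ : IsAdmissibleSwitching P μ E p)
    (hr : IsZMWSSI P μ p r) (w : List (Fin d)) (σ τ : Fin d) (t : ℤ) (i j : ι) {c : ℝ}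
    (hc : P[fun ω => switchProd μ (w ++ [τ]) t ω * μ t ω σ | sigmaBefore μ t] =ᵐ[P]
      fun ω => c * switchProd μ w (t - 1) ω) :
    ∫ ω, zProc μ p r [σ] (t + 1) ω i * zProc μ p r (w ++ [τ]) (t + 1) ω j ∂P =
      c / (√(p σ) * √(p τ)) * ∫ ω, r t ω i * zProc μ p r w t ω j ∂P := by
  have hσ := (Real.sqrt_pos.2 (hμ.p_pos σ)).ne'
  have hτ := (Real.sqrt_pos.2 (hμ.p_pos τ)).ne'
  have hw := (Real.sqrt_pos.2 (wordWeight_pos hμ.p_pos w)).ne'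
  have hμle : ∀ k, MeasurableSpace.comap (μ k) MeasurableSpace.pi ≤ ‹MeasurableSpace Ω› :=
    fun k => (hμ.measurable k).comap_le
  have hbefore : sigmaBefore μ t ≤ ‹MeasurableSpace Ω› := iSup₂_le fun k _ => hμle k
  have hfrom : sigmaFrom μ t ≤ ‹MeasurableSpace Ω› := iSup₂_le fun k _ => hμle k
  have hupto : sigmaUpTo r t ≤ ‹MeasurableSpace Ω› :=
    iSup₂_le fun k _ => (hr.measurable k).comap_le
  -- The integrand separates into values of `r` up to time `t` and a product of values of `μ` up to
  -- time `t`, the two kinds of factor to which conditional independence applies.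
  have hsplit : ∀ ω, zProc μ p r [σ] (t + 1) ω i * zProc μ p r (w ++ [τ]) (t + 1) ω j =
      (1 / (√(p σ) * √(p τ) * √(wordWeight p w))) * ((r t ω i * r (t - w.length) ω j) *
        (switchProd μ (w ++ [τ]) t ω * μ t ω σ)) := by
    intro ω
    rw [zProc_singleton, zProc_concat hμ.p_pos, switchProd_concat, zProc]
    simp only [add_sub_cancel_right]
    field_simp
  have hsplit' : ∀ ω, r t ω i * zProc μ p r w t ω j = (1 / √(wordWeight p w)) *
      ((r t ω i * r (t - w.length) ω j) * switchProd μ w (t - 1) ω) := by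
    intro ω
    rw [zProc]
    field_simp
  have hr0 : MemLp (fun ω => r t ω i) 2 P := by
    simpa only [zProc_nil] using hr.memLp_zProc [] t i
  have hint := (hr.memLp_zProc [σ] (t + 1) i).integrable_mul (hr.memLp_zProc (w ++ [τ]) (t + 1) j)
  have hint' := hr0.integrable_mul (hr.memLp_zProc w t j)
  have hi1 : Integrable (fun ω => (r t ω i * r (t - w.length) ω j) *
      (switchProd μ (w ++ [τ]) t ω * μ t ω σ)) P := by
    refine (hint.const_mul (√(p σ) * √(p τ) * √(wordWeight p w))).congr (ae_of_all _ fun ω => ?_)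
    simp only [Pi.mul_apply]
    rw [hsplit]
    field_simp
  have hi2 : Integrable (fun ω => (r t ω i * r (t - w.length) ω j) *
      (c * switchProd μ w (t - 1) ω)) P := by
    refine (hint'.const_mul (c * √(wordWeight p w))).congr (ae_of_all _ fun ω => ?_)
    simp only [Pi.mul_apply]
    rw [hsplit']
    field_simp
  have hGi : Integrable (fun ω => switchProd μ (w ++ [τ]) t ω * μ t ω σ) P := by
    have h1 := (hμ.memLp_switchProd (w := w ++ [τ]) (by simp) t).integrable_mul
      (hμ.memLp_switchProd (w := [σ]) (by simp) t)
    simpa [switchProd, Pi.mul_def] using h1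
  have hGm : Measurable[sigmaBefore μ t ⊔ sigmaFrom μ t]
      fun ω => switchProd μ (w ++ [τ]) t ω * μ t ω σ := by
    have hlast : ∀ ρ : Fin d, Measurable[sigmaBefore μ t ⊔ sigmaFrom μ t] fun ω => μ t ω ρ :=
      fun ρ => (measurable_sigmaFrom_apply le_rfl ρ).mono le_sup_right le_rfl
    have hpre : Measurable[sigmaBefore μ t ⊔ sigmaFrom μ t] (switchProd μ w (t - 1)) :=
      (measurable_switchProd w (by omega)).mono le_sup_left le_rfl
    simp only [switchProd_concat]
    exact Measurable.mul (Measurable.mul hpre (hlast τ)) (hlast σ)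
  have hfm : Measurable[sigmaUpTo r t] fun ω => r t ω i * r (t - w.length) ω j :=
    Measurable.mul (measurable_sigmaUpTo_apply le_rfl i)
      (measurable_sigmaUpTo_apply (by omega) j)
  have key := (hr.condIndep t).integral_mul_condExp hbefore hupto hfrom hfm.stronglyMeasurable
    hGm.stronglyMeasurable hGi hc hi1 hi2
  simp only [hsplit, hsplit', integral_const_mul]
  rw [key]
  have : ∀ ω, r t ω i * r (t - w.length) ω j * (c * switchProd μ w (t - 1) ω) =
      c * (r t ω i * r (t - w.length) ω j * switchProd μ w (t - 1) ω) := fun ω => by ring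
  simp only [this, integral_const_mul]
  field_simp

/-- Different last letters have conditionally uncorrelated switching values, so the constant in
`integral_zProc_mul_zProc` is `0`. The empty `w` falls under a separate admissibility axiom. -/
theorem IsZMWSSI.integral_zProc_mul_zProc_of_ne (hμ : IsAdmissibleSwitching P μ E p)
    (hr : IsZMWSSI P μ p r) (w : List (Fin d)) {σ τ : Fin d} (hστ : σ ≠ τ) (t : ℤ) (i j : ι) :
    ∫ ω, zProc μ p r [σ] t ω i * zProc μ p r (w ++ [τ]) t ω j ∂P = 0 := by
  have hc : P[fun ω => switchProd μ (w ++ [τ]) (t - 1) ω * μ (t - 1) ω σ |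
      sigmaBefore μ (t - 1)] =ᵐ[P] fun ω => 0 * switchProd μ w (t - 1 - 1) ω := by
    simp only [zero_mul]
    by_cases hw : w = []
    · subst hw
      simpa [switchProd] using hμ.condExp_letters τ σ (t - 1) hστ.symm
    · exact hμ.condExp_letter_other w τ σ (t - 1) hw fun h => hστ h.1.symm
  simpa using hr.integral_zProc_mul_zProc hμ w σ τ (t - 1) i j hc

/-- The constant `p_σ` from the conditional expectation cancels the two normalizations `√p_σ`. The
word `w` must be nonempty: admissibility prescribes no value for `E[μ_σ² | past]`. -/
theorem IsZMWSSI.integral_zProc_mul_zProc_same (hμ : IsAdmissibleSwitching P μ E p)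
    (hr : IsZMWSSI P μ p r) {w : List (Fin d)} (hw : w ≠ []) {σ : Fin d}
    (hwσ : IsAdmissibleWord E (w ++ [σ])) (t : ℤ) (i j : ι) :
    ∫ ω, zProc μ p r [σ] t ω i * zProc μ p r (w ++ [σ]) t ω j ∂P =
      ∫ ω, r (t - 1) ω i * zProc μ p r w (t - 1) ω j ∂P := by
  have h := hr.integral_zProc_mul_zProc hμ w σ σ (t - 1) i j
    (hμ.condExp_letter_same w σ (t - 1) hw hwσ)
  rw [Real.mul_self_sqrt (hμ.p_pos σ).le, div_self (hμ.p_pos σ).ne', one_mul,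
    sub_add_cancel] at h
  exact h

end Moments

/-! ### State-noise correlations and Markov parameters. -/

section StateMoments

variable {Ω : Type*} [MeasurableSpace Ω] {P : Measure Ω}

theorem crossMoment_congr {ι κ : Type*} {f f' : Ω → ι → ℝ} {g g' : Ω → κ → ℝ}
    (hf : f =ᵐ[P] f') (hg : g =ᵐ[P] g') : crossMoment P f g = crossMoment P f' g' := by
  ext i j
  refine integral_congr_ae ?_
  filter_upwards [hf, hg] with ω h1 h2
  rw [h1, h2]

theorem crossMoment_mulVec {ι κ l : Type*} [Fintype ι] (M : Matrix l ι ℝ) {f : Ω → ι → ℝ}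
    {g : Ω → κ → ℝ} (h : ∀ i j, Integrable (fun ω => f ω i * g ω j) P) :
    crossMoment P (fun ω => M.mulVec (f ω)) g = M * crossMoment P f g := by
  ext a j
  simp only [crossMoment, Matrix.of_apply, Matrix.mul_apply, Matrix.mulVec, dotProduct,
    Finset.sum_mul, mul_assoc]
  rw [integral_finsetSum _ fun i _ => (h i j).const_mul _]
  simp only [integral_const_mul]

variable {d n nu ny nv : ℕ}
  {μ : ℤ → Ω → Fin d → ℝ} {E : Fin d → Fin d → Prop} {p : Fin d → ℝ}
  {y : ℤ → Ω → Fin ny → ℝ} {u : ℤ → Ω → Fin nu → ℝ}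
  {S : GLSS d n nu ny nv} {v : ℤ → Ω → Fin nv → ℝ} {x : ℤ → Ω → Fin n → ℝ}

theorem IsSGLSSWithState.memLp_zProc_state (hS : IsSGLSSWithState P μ E p y u S v x)
    (w : List (Fin d)) (t : ℤ) (i : Fin n) : MemLp (fun ω => zProc μ p x w t ω i) 2 P :=
  hS.zmwssi.memLp_zProc w t (Sum.inl i)

/-- The state equation at time `t - 1`, with `√p_σ` undoing the normalization of `z_σ`. The blocks
appear as `[K_σ, B_σ]` because the noise precedes the input in `stack v u`. -/
theorem IsSGLSSWithState.state_ae_eq (hμ : IsAdmissibleSwitching P μ E p)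
    (hS : IsSGLSSWithState P μ E p y u S v x) (t : ℤ) : ∀ᵐ ω ∂P, x t ω = ∑ σ, √(p σ) •
      ((S.A σ).mulVec (zProc μ p x [σ] t ω) +
        (Matrix.fromCols (S.K σ) (S.B σ)).mulVec (zProc μ p (stack v u) [σ] t ω)) := by
  filter_upwards [hS.state_eq (t - 1)] with ω hω
  rw [sub_add_cancel] at hω
  rw [hω]
  refine Finset.sum_congr rfl fun σ _ => ?_
  have hσ := (Real.sqrt_pos.2 (hμ.p_pos σ)).ne'
  have hz : ∀ {κ : Type} (r : ℤ → Ω → κ → ℝ), zProc μ p r [σ] t ω =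
      (μ (t - 1) ω σ / √(p σ)) • r (t - 1) ω := by
    intro κ r
    funext i
    rw [zProc_singleton, Pi.smul_apply, smul_eq_mul]
    ring
  rw [hz, hz, Matrix.mulVec_smul, Matrix.mulVec_smul, ← smul_add, smul_smul,
    mul_div_cancel₀ _ hσ, stack, Matrix.fromCols_mulVec]
  simp only [Sum.elim_comp_inl, Sum.elim_comp_inr]
  rw [add_assoc, add_comm ((S.B σ).mulVec _)]

theorem IsSGLSSWithState.crossMoment_state (hμ : IsAdmissibleSwitching P μ E p)
    (hS : IsSGLSSWithState P μ E p y u S v x) (t : ℤ) {κ : Type*} {g : Ω → κ → ℝ}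
    (hg : ∀ j, MemLp (fun ω => g ω j) 2 P) :
    crossMoment P (x t) g = ∑ σ, √(p σ) • (S.A σ * crossMoment P (zProc μ p x [σ] t) g +
      Matrix.fromCols (S.K σ) (S.B σ) * crossMoment P (zProc μ p (stack v u) [σ] t) g) := by
  have h1 : ∀ σ i j, Integrable (fun ω => zProc μ p x [σ] t ω i * g ω j) P := fun σ i j =>
    (hS.memLp_zProc_state [σ] t i).integrable_mul (hg j)
  have h2 : ∀ σ i j, Integrable (fun ω => zProc μ p (stack v u) [σ] t ω i * g ω j) P :=
    fun σ i j => (hS.whiteNoise.zmwssi.memLp_zProc [σ] t i).integrable_mul (hg j)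
  have h3 : ∀ {ι l : Type} [Fintype ι] (M : Matrix l ι ℝ) {f : Ω → ι → ℝ},
      (∀ i j, Integrable (fun ω => f ω i * g ω j) P) → ∀ a j,
      Integrable (fun ω => (M.mulVec (f ω)) a * g ω j) P := by
    intro ι l _ M f hf a j
    simp only [Matrix.mulVec, dotProduct, Finset.sum_mul, mul_assoc]
    exact integrable_finsetSum _ fun i _ => (hf i j).const_mul _
  rw [crossMoment_congr (hS.state_ae_eq hμ t) (ae_eq_refl g)]
  ext i j
  simp only [← crossMoment_mulVec _ (h1 _), ← crossMoment_mulVec _ (h2 _)]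
  simp only [crossMoment, Matrix.of_apply, Matrix.sum_apply, Matrix.smul_apply, Matrix.add_apply,
    Finset.sum_apply, Pi.smul_apply, Pi.add_apply, smul_eq_mul, Finset.sum_mul, mul_assoc,
    add_mul]
  refine (integral_finsetSum _ fun σ _ =>
    ((h3 _ (h1 σ) i j).add (h3 _ (h2 σ) i j)).const_mul _).trans ?_
  refine Finset.sum_congr rfl fun σ _ => ?_
  rw [integral_const_mul, integral_add' (h3 _ (h1 σ) i j) (h3 _ (h2 σ) i j)]

/-- The noise covariance in the edge condition is nonsingular and can be cancelled. -/
theorem IsSGLSSWithState.A_mul_fromCols_eq_zero (hS : IsSGLSSWithState P μ E p y u S v x)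
    {σ τ : Fin d} (h : ¬ E σ τ) : S.A τ * Matrix.fromCols (S.K σ) (S.B σ) = 0 := by
  have h0 := hS.edge_KB σ τ h 0
  have hdet := hS.whiteNoise.nonsingular σ 0
  rw [← Matrix.mul_nonsing_inv_cancel_right _ (S.A τ * Matrix.fromCols (S.K σ) (S.B σ))
    (isUnit_iff_ne_zero.2 hdet), h0, Matrix.zero_mul]

variable [IsProbabilityMeasure P]

/-- `E[x(t) z_{τw}(t)ᵀ] = √p_{τw} A_w [K_τ, B_τ] Q_τ` for admissible words `τw`, where `z` is built
from the noise `[vᵀ, uᵀ]ᵀ`. -/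
theorem IsSGLSSWithState.crossMoment_state_noise (hμ : IsAdmissibleSwitching P μ E p)
    (hS : IsSGLSSWithState P μ E p y u S v x) (τ : Fin d) (w : List (Fin d))
    (hw : (τ :: w).IsChain E) (t : ℤ) :
    crossMoment P (x t) (zProc μ p (stack v u) (τ :: w) t) =
      √(wordWeight p (τ :: w)) • (wordProd S.A w * Matrix.fromCols (S.K τ) (S.B τ) *
        crossMoment P (zProc μ p (stack v u) [τ] (t - w.length))
          (zProc μ p (stack v u) [τ] (t - w.length))) := by
  have hstate : ∀ {w' : List (Fin d)} {σ ρ : Fin d} (t : ℤ), σ ≠ ρ →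
      crossMoment P (zProc μ p x [σ] t) (zProc μ p (stack v u) (w' ++ [ρ]) t) = 0 := by
    intro w' σ ρ t hne
    ext i j
    exact hS.zmwssi.integral_zProc_mul_zProc_of_ne hμ w' hne t (Sum.inl i) (Sum.inr j)
  -- Only the term of the last letter survives in the state recursion: the others vanish by the
  -- switching moments and whiteness. For a single letter the noise term remains and the state term
  -- is zero by `cross_same`. For longer words the noise term is zero, since the words have
  -- different lengths, and the state term is the same moment one time unit earlier, with the last
  -- letter removed.
  induction w using List.reverseRecOn generalizing t with
  | nil =>
    rw [hS.crossMoment_state hμ t (hS.whiteNoise.zmwssi.memLp_zProc [τ] t),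
      Finset.sum_eq_single τ]
    · simp [hS.cross_same, wordProd, wordWeight]
    · intro σ _ hne
      have h1 := hstate (w' := []) t hne
      rw [List.nil_append] at h1
      rw [h1, hS.whiteNoise.uncorrelated [σ] [τ] t (by simp) (by simp) (by simpa using hne)]
      simp
    · simp
  | append_singleton w ρ ih =>
    have hchain : (τ :: w ++ [ρ]).IsChain E := hw
    have hadm : IsAdmissibleWord E (τ :: w ++ [ρ]) := ⟨by simp, hchain⟩
    rw [show τ :: (w ++ [ρ]) = τ :: w ++ [ρ] from rfl,
      hS.crossMoment_state hμ t (hS.whiteNoise.zmwssi.memLp_zProc _ t),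
      Finset.sum_eq_single ρ]
    · have h1 : crossMoment P (zProc μ p x [ρ] t) (zProc μ p (stack v u) (τ :: w ++ [ρ]) t) =
          crossMoment P (x (t - 1)) (zProc μ p (stack v u) (τ :: w) (t - 1)) := by
        ext i j
        exact hS.zmwssi.integral_zProc_mul_zProc_same hμ (by simp) hadm t (Sum.inl i) (Sum.inr j)
      rw [h1, hS.whiteNoise.uncorrelated [ρ] (τ :: w ++ [ρ]) t (by simp) (by simp)
        (by intro h; simpa using congrArg List.length h), ih hchain.left_of_append,
        wordWeight_concat, Real.sqrt_mul (wordWeight_pos hμ.p_pos _).le, wordProd_concat,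
        List.length_append, List.length_singleton, Nat.cast_add, Nat.cast_one,
        show t - 1 - (w.length : ℤ) = t - ((w.length : ℤ) + 1) by ring]
      simp only [Matrix.mul_zero, add_zero, Matrix.mul_smul, smul_smul, Matrix.mul_assoc]
      rw [mul_comm]
    · intro σ _ hne
      rw [hstate t hne, hS.whiteNoise.uncorrelated [σ] (τ :: w ++ [ρ]) t (by simp) (by simp)
        (by intro h; simpa using congrArg List.length h)]
      simp
    · simp

end StateMoments

/-- The correlation of `Cx = y - Du - Fv` with `z_{τw}^ω` does not depend on which system it is
computed from; evaluating it in both and cancelling the common weight and noise covariance compares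
the parameters. If `τw` is not admissible, both sides are zero. -/
theorem markov_eq_of_isSGLSSWithState {Ω : Type*} [MeasurableSpace Ω] {P : Measure Ω}
    [IsProbabilityMeasure P] {d n nh nu ny nv : ℕ} {μ : ℤ → Ω → Fin d → ℝ}
    {E : Fin d → Fin d → Prop} {p : Fin d → ℝ} (hμ : IsAdmissibleSwitching P μ E p)
    {y : ℤ → Ω → Fin ny → ℝ} {u : ℤ → Ω → Fin nu → ℝ}
    {S : GLSS d n nu ny nv} {v : ℤ → Ω → Fin nv → ℝ} {x : ℤ → Ω → Fin n → ℝ}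
    {Sh : GLSS d nh nu ny nv} {vh : ℤ → Ω → Fin nv → ℝ} {xh : ℤ → Ω → Fin nh → ℝ}
    (hS : IsSGLSSWithState P μ E p y u S v x) (hSh : IsSGLSSWithState P μ E p y u Sh vh xh)
    (hv : ∀ t, v t =ᵐ[P] vh t) (hD : Sh.D = S.D) (hF : Sh.F = S.F)
    (w : List (Fin d)) (τ : Fin d) :
    S.C * wordProd S.A w * Matrix.fromCols (S.K τ) (S.B τ) =
      Sh.C * wordProd Sh.A w * Matrix.fromCols (Sh.K τ) (Sh.B τ) := by
  by_cases hw : (τ :: w).IsChain E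
  · have hz : ∀ w' t, zProc μ p (stack v u) w' t =ᵐ[P] zProc μ p (stack vh u) w' t := by
      intro w' t
      filter_upwards [hv (t - w'.length)] with ω hω
      funext i
      cases i <;> simp [zProc, stack, hω]
    have hout : (fun ω => S.C.mulVec (x 0 ω)) =ᵐ[P] fun ω => Sh.C.mulVec (xh 0 ω) := by
      filter_upwards [hS.output_eq 0, hSh.output_eq 0, hv 0] with ω h1 h2 h3
      rw [h1, hD, hF, h3] at h2
      simpa using h2
    have hint : ∀ i j, Integrable (fun ω => x 0 ω i * zProc μ p (stack v u) (τ :: w) 0 ω j) P := by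
      intro i j
      have := hS.memLp_zProc_state [] 0 i
      rw [zProc_nil] at this
      exact this.integrable_mul (hS.whiteNoise.zmwssi.memLp_zProc (τ :: w) 0 j)
    have hinth : ∀ i j,
        Integrable (fun ω => xh 0 ω i * zProc μ p (stack vh u) (τ :: w) 0 ω j) P := by
      intro i j
      have := hSh.memLp_zProc_state [] 0 i
      rw [zProc_nil] at this
      exact this.integrable_mul (hSh.whiteNoise.zmwssi.memLp_zProc (τ :: w) 0 j)
    have h1 := crossMoment_mulVec S.C hint
    have h2 := crossMoment_mulVec Sh.C hinth
    rw [crossMoment_congr hout (hz (τ :: w) 0), h2,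
      hS.crossMoment_state_noise hμ τ w hw 0, hSh.crossMoment_state_noise hμ τ w hw 0,
      ← crossMoment_congr (hz [τ] _) (hz [τ] _), Matrix.mul_smul, Matrix.mul_smul] at h1
    have h3 := smul_right_injective _ (Real.sqrt_pos.2 (wordWeight_pos hμ.p_pos (τ :: w))).ne' h1
    have hu := isUnit_iff_ne_zero.2 (hS.whiteNoise.nonsingular τ (0 - w.length))
    simp only [← Matrix.mul_assoc] at h3
    rw [← Matrix.mul_nonsing_inv_cancel_right _ (S.C * _ * _) hu, ← h3,
      Matrix.mul_nonsing_inv_cancel_right _ _ hu]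
  · rw [Matrix.mul_assoc, Matrix.mul_assoc,
      wordProd_mul_eq_zero_of_not_isChain hS.edge_A (fun _ _ => hS.A_mul_fromCols_eq_zero) hw,
      wordProd_mul_eq_zero_of_not_isChain hSh.edge_A (fun _ _ => hSh.A_mul_fromCols_eq_zero) hw,
      Matrix.mul_zero, Matrix.mul_zero]

theorem IsSGLSSWithState.reachableSpace_eq_top {Ω : Type*} [MeasurableSpace Ω] {P : Measure Ω}
    {d n nu ny nv : ℕ} {μ : ℤ → Ω → Fin d → ℝ}
    {E : Fin d → Fin d → Prop} {p : Fin d → ℝ}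
    {y : ℤ → Ω → Fin ny → ℝ} {u : ℤ → Ω → Fin nu → ℝ}
    {S : GLSS d n nu ny nv} {v : ℤ → Ω → Fin nv → ℝ} {x : ℤ → Ω → Fin n → ℝ}
    (hS : IsSGLSSWithState P μ E p y u S v x) (h : IsStochReachable P μ E p S v) :
    reachableSpace S.A (fun σ => Matrix.fromCols (S.K σ) (S.B σ)) = ⊤ := by
  obtain ⟨X, hX, hG⟩ := h
  have hK : ∀ σ τ, ¬ E σ τ → S.A τ * S.K σ = 0 := by
    intro σ τ hE
    have := hS.A_mul_fromCols_eq_zero hE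
    rw [Matrix.mul_fromCols, ← Matrix.fromCols_zero, Matrix.fromCols_ext_iff] at this
    exact this.1
  have htop := reachableSpace_eq_top_of_stateOutputCov hX hS.stable hS.edge_A hK hG
  rw [eq_top_iff, ← htop]
  refine reachableSpace_le _ _ _ fun σ η => ?_
  -- Feeding zero into the `B_σ` block recovers the columns of `K_σ`.
  have := input_mulVec_mem_reachableSpace S.A
    (fun σ => Matrix.fromCols (S.K σ) (S.B σ)) σ (Sum.elim η 0)
  simpa [Matrix.fromCols_mulVec] using this

theorem corollary3 {Ω : Type*} [MeasurableSpace Ω] (P : Measure Ω) [IsProbabilityMeasure P]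
    {d n nh nu ny : ℕ}
    (μ : ℤ → Ω → Fin d → ℝ) (E : Fin d → Fin d → Prop) (p : Fin d → ℝ)
    (hμ : IsAdmissibleSwitching P μ E p)
    (y : ℤ → Ω → Fin ny → ℝ) (u : ℤ → Ω → Fin nu → ℝ)
    (S : GLSS d n nu ny ny) (v : ℤ → Ω → Fin ny → ℝ)
    (Sh : GLSS d nh nu ny ny) (vh : ℤ → Ω → Fin ny → ℝ)
    (hS : IsSGLSS P μ E p y u S v) (hSh : IsSGLSS P μ E p y u Sh vh)
    (hinn : IsInnovationForm P μ p y u S v) (hinnh : IsInnovationForm P μ p y u Sh vh)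
    (hreach : IsStochReachable P μ E p S v) (hreachh : IsStochReachable P μ E p Sh vh)
    (hobs : IsStochObservable S) (hobsh : IsStochObservable Sh)
    (hcov : ∀ (σ : Fin d) (t : ℤ),
      (switchedCov P μ (stochInnovation P μ p y u) σ t).det ≠ 0)
    (him : ∀ σ : Fin d,
      LinearMap.range (Matrix.fromRows (S.B σ) (Sh.B σ)).mulVecLin ≤
        LinearMap.range (Matrix.fromRows (S.K σ) (Sh.K σ)).mulVecLin)
    (hD : Sh.D = S.D) :
    ∃ (T : Matrix (Fin nh) (Fin n) ℝ) (Tinv : Matrix (Fin n) (Fin nh) ℝ),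
      T * Tinv = 1 ∧ Tinv * T = 1 ∧
      (∀ σ : Fin d, T * S.A σ * Tinv = Sh.A σ ∧
        T * Matrix.fromCols (S.K σ) (S.B σ) = Matrix.fromCols (Sh.K σ) (Sh.B σ)) ∧
      S.C * Tinv = Sh.C := by

  obtain ⟨x, hx⟩ := hS
  obtain ⟨xh, hxh⟩ := hSh
  exact exists_isomorphism_of_markov_eq S.A (fun σ => Matrix.fromCols (S.K σ) (S.B σ)) S.C
    Sh.A (fun σ => Matrix.fromCols (Sh.K σ) (Sh.B σ)) Sh.C
    (hx.reachableSpace_eq_top hreach) (hxh.reachableSpace_eq_top hreachh) hobs hobsh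
    (markov_eq_of_isSGLSSWithState hμ hx hxh (fun t => (hinn.2 t).trans (hinnh.2 t).symm) hD
      (hinnh.1.trans hinn.1.symm))
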